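/- Let $m\ge 1$, let $\mathrm{Tr}_m:\mathbb{F}_{2^m}\to\mathbb{F}_2$ be the absolute trace and put $n=2m$. Let $F\in\mathbb{F}_{2^m}[X,Y]$ be such that $f(x,y)=\mathrm{Tr}_m(F(x,y))$ is a quadratic Boolean function on $\mathbb{F}_{2^m}\times\mathbb{F}_{2^m}$, i.e. of algebraic degree at most $2$. For a direction $(u,v)\in\mathbb{F}_{2^m}^2$ let $$\tilde D_{u,v}f(x,y)=f(x+u,y+v)+f(x,y)+f(u,v)+f(0,0)$$ be the linear part of the derivative of $f$ in direction $(u,v)$. Let $A,B\in\mathbb{F}_{2^m}[X,Y]$ be polynomials such that, for some integers $\delta_1,\delta_2\ge 0$, $$\tilde D_{u,v}f(x,y)=\mathrm{Tr}_m\big(A(u,v)\,x^{2^{\delta_1}}+B(u,v)\,y^{2^{\delta_2}}\big)\qquad\text{for all } u,v,x,y\in\mathbb{F}_{2^m}.$$ Suppose that, for some integer $k\ge 0$ with $\gcd(k,m)=1$, both $A$ and $B$ are of the form $$C_0X+D_0Y+C_1X^{2^k}+D_1Y^{2^k}+\cdots+C_dX^{2^{dk}}+D_dY^{2^{dk}},\qquad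 C_i,D_i\in\mathbb{F}_{2^m},$$ that $A$ has degree $2^{kd_1}$ and $B$ has degree $2^{kd_2}$ with integers $d_1,d_2\ge 0$, and that $A$ and $B$ have no non-constant common factor. Then there is an integer $s$ with $0\le s\le d_1+d_2$ such that $f$ is $s$-plateaued: $n+s$ is even and every value $\sum_{x,y}(-1)^{f(x,y)+\mathrm{Tr}_m(ax+by)}$, $(a,b)\in\mathbb{F}_{2^m}^2$, of the Walsh transform of $f$ lies in $\{0,2^{(n+s)/2},-2^{(n+s)/2}\}$. If, in addition, the projective plane curves over the algebraic closure $\overline{\mathbb{F}_{2^m}}$ with affine equations $A=0$ and $B=0$ have a common point (affine or at infinity) at which their intersection multiplicity is larger than $1$, then $s<d_1+d_2$. -/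

import Mathlib

noncomputable section

namespace PlaneBoolean

open MvPolynomial

/-! ### Boolean functions on a two-dimensional space over a finite field of characteristic two -/

section Boolean

variable {K : Type*} [Field K] [Fintype K] [Algebra (ZMod 2) K]

/-- The Boolean function `(x, y) ↦ Tr (F (x, y))`, with `Tr` the absolute trace. -/
def traceFun (F : MvPolynomial (Fin 2) K) (z : K × K) : ZMod 2 :=
  Algebra.trace (ZMod 2) K (eval ![z.1, z.2] F)

/-- The nondegenerate inner product `Tr (x u + y v)` on `K × K`. -/
def traceInner (z w : K × K) : ZMod 2 :=
  Algebra.trace (ZMod 2) K (z.1 * w.1 + z.2 * w.2)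

/-- The Walsh transform `∑ z, (-1) ^ (f z + ⟨z, w⟩)`, an integer. -/
def walsh (f : K × K → ZMod 2) (w : K × K) : ℤ :=
  ∑ z : K × K, (-1 : ℤ) ^ (f z + traceInner z w).val

/-- With `n = dim (K × K)`: all Walsh values lie in `{0, 2 ^ ((n + s) / 2), -2 ^ ((n + s) / 2)}`,
where `n + s` is even. -/
def IsPlateaued (f : K × K → ZMod 2) (s : ℕ) : Prop :=
  Even (Module.finrank (ZMod 2) (K × K) + s) ∧
    ∀ w : K × K, walsh f w ∈
      ({0, 2 ^ ((Module.finrank (ZMod 2) (K × K) + s) / 2),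
        -2 ^ ((Module.finrank (ZMod 2) (K × K) + s) / 2)} : Set ℤ)

/-- The function has algebraic degree at most `2`: in the coordinates of a basis over the field with
two elements it is given by a polynomial of total degree at most `2`. -/
def IsQuadratic (f : K × K → ZMod 2) : Prop :=
  ∃ P : MvPolynomial (Fin (Module.finrank (ZMod 2) (K × K))) (ZMod 2), P.totalDegree ≤ 2 ∧
    ∀ z : K × K, f z = eval (fun i => (Module.finBasis (ZMod 2) (K × K)).repr z i) P

/-- The linear part `z ↦ D_a f (z) - D_a f (0)` of the derivative `D_a f (z) = f (z + a) + f z`. -/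
def derivLinearPart (f : K × K → ZMod 2) (a z : K × K) : ZMod 2 :=
  (f (z + a) + f z) + (f a + f 0)

/-- `A` and `B` represent the linear parts of the derivatives of `f`: for some exponents
`δ₁, δ₂`, the linear part of the derivative in direction `(u, v)` is
`Tr (A (u, v) x ^ (2 ^ δ₁) + B (u, v) y ^ (2 ^ δ₂))`. -/
def RepresentsDeriv (f : K × K → ZMod 2) (A B : MvPolynomial (Fin 2) K) : Prop :=
  ∃ δ₁ δ₂ : ℕ, ∀ u v x y : K,
    derivLinearPart f (u, v) (x, y) =
      Algebra.trace (ZMod 2) K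
        (eval ![u, v] A * x ^ (2 ^ δ₁) + eval ![u, v] B * y ^ (2 ^ δ₂))

end Boolean

/-- Polynomials of the form
`C₀ X + D₀ Y + C₁ X ^ (2 ^ k) + D₁ Y ^ (2 ^ k) + ⋯ + C_d X ^ (2 ^ (d k)) + D_d Y ^ (2 ^ (d k))`. -/
def IsLinearized {K : Type*} [Field K] (k : ℕ) (p : MvPolynomial (Fin 2) K) : Prop :=
  ∃ (d : ℕ) (c e : ℕ → K),
    p = ∑ i ∈ Finset.range (d + 1),
      (C (c i) * X 0 ^ (2 ^ (i * k)) + C (e i) * X 1 ^ (2 ^ (i * k)))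

/-! ### Intersection multiplicities of projective plane curves -/

section Curves

variable {L : Type*} [Field L]

instance isPrime_ker_eval (P : Fin 2 → L) : (RingHom.ker (eval P)).IsPrime :=
  RingHom.ker_isPrime _

/-- The intersection multiplicity at the affine point `P` of the curves `f = 0` and `g = 0`:
the dimension of `O_P / (f, g)`, with `O_P` the local ring of the affine plane at `P`. -/
def affineMult (f g : MvPolynomial (Fin 2) L) (P : Fin 2 → L) : ℕ∞ :=
  Cardinal.toENat <| Module.rank L
    (Localization.AtPrime (RingHom.ker (eval P)) ⧸
      Ideal.span {algebraMap (MvPolynomial (Fin 2) L) (Localization.AtPrime (RingHom.ker (eval P))) f,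
        algebraMap (MvPolynomial (Fin 2) L) (Localization.AtPrime (RingHom.ker (eval P))) g})

/-- The homogenization `Z ^ (deg f) f (X / Z, Y / Z)`. -/
def homogenization (f : MvPolynomial (Fin 2) L) : MvPolynomial (Fin 3) L :=
  ∑ t ∈ f.support,
    C (coeff t f) * X 0 ^ (t 0) * X 1 ^ (t 1) * X 2 ^ (f.totalDegree - (t 0 + t 1))

/-- The polynomial in the two remaining variables obtained by setting the `i`-th variable to `1`. -/
def dehomogenization (i : Fin 3) (F : MvPolynomial (Fin 3) L) : MvPolynomial (Fin 2) L :=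
  aeval (Fin.insertNth (α := fun _ => MvPolynomial (Fin 2) L) i 1 X) F

/-- A coordinate which does not vanish at the point `P` of the projective plane. -/
def chart (P : Projectivization L (Fin 3 → L)) : Fin 3 :=
  (Function.ne_iff.mp P.rep_nonzero).choose

/-- The intersection multiplicity, at a point `P` of the projective plane, of the projective closures
of `f = 0` and `g = 0`, computed in an affine chart that contains `P`. -/
def projMult (f g : MvPolynomial (Fin 2) L) (P : Projectivization L (Fin 3 → L)) : ℕ∞ :=
  affineMult (dehomogenization (chart P) (homogenization f))
    (dehomogenization (chart P) (homogenization g))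
    (fun j => P.rep ((chart P).succAbove j) / P.rep (chart P))

end Curves

/-- Over the algebraic closure, the projective closures of the curves `A = 0` and `B = 0` have a
common point (affine or at infinity) at which their intersection multiplicity exceeds `1`. -/
def MeetWithMultGtOne {K : Type*} [Field K] (A B : MvPolynomial (Fin 2) K) : Prop :=
  ∃ P : Projectivization (AlgebraicClosure K) (Fin 3 → AlgebraicClosure K),
    eval P.rep (homogenization (map (algebraMap K (AlgebraicClosure K)) A)) = 0 ∧
    eval P.rep (homogenization (map (algebraMap K (AlgebraicClosure K)) B)) = 0 ∧
    1 < projMult (map (algebraMap K (AlgebraicClosure K)) A)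
      (map (algebraMap K (AlgebraicClosure K)) B) P

end PlaneBoolean

end

noncomputable section

set_option linter.unusedSectionVars false

open PlaneBoolean MvPolynomial

/-! The form (a, z) ↦ D̃_a f(z) is symmetric and additive. Squaring a Walsh sum leaves only a sum
over its radical, so every squared value is 0 or 2 ^ (n + s), with s the dimension of the radical
(`walsh_sq`). Since the trace form is nondegenerate and Frobenius is bijective, the radical is the
set Z of common zeros of A and B in K × K.

The bound on dim Z uses a dimension count in place of Bézout's theorem. Put N = d₁ + d₂ + m.
Linearized polynomials with exponents 2 ^ (ik), i < N, form a K-space of dimension at most 2N. As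
gcd(k, m) = 1 and m ≤ N, they induce all 𝔽₂-linear maps Z → K, so those vanishing on Z have
dimension at most 2N - dim Z (`finrank_add_finrank_le`). Among these are d₂ + m Frobenius powers of
A and d₁ + m of B, independent because A and B are coprime (`linearIndependent_powFamily`). Hence
dim Z ≤ d₁ + d₂.

A common point at infinity makes the leading forms of A and B proportional after Frobenius powers;
at an affine point, multiplicity above 1 makes the linear parts proportional, since the Jacobian is
constant. Either dependence yields one more linearized polynomial vanishing on Z, outside the span
of those powers, and the bound becomes strict. -/

theorem neg_one_pow_val_add (a b : ZMod 2) :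
    (-1 : ℤ) ^ (a + b).val = (-1) ^ a.val * (-1) ^ b.val := by
  revert a b; decide

/-- Translation by a point where g is 1 permutes the summands and flips every sign. -/
theorem sum_neg_one_pow_eq_zero {G : Type*} [AddCommGroup G] [Fintype G] (g : G → ZMod 2)
    (hg : ∀ a b, g (a + b) = g a + g b) (h : ∃ a, g a ≠ 0) :
    ∑ a : G, (-1 : ℤ) ^ (g a).val = 0 := by
  obtain ⟨b, hb⟩ := h
  have hb1 : (-1 : ℤ) ^ (g b).val = -1 := by
    revert hb; generalize g b = c; revert c; decide
  have h1 : ∑ a : G, (-1 : ℤ) ^ (g a).val = ∑ a : G, (-1 : ℤ) ^ (g (a + b)).val :=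
    (Equiv.sum_comp (Equiv.addRight b) fun a => (-1 : ℤ) ^ (g a).val).symm
  simp_rw [hg, neg_one_pow_val_add, hb1, ← Finset.sum_mul] at h1
  linarith

theorem derivLinearPart_comm {K : Type*} [Field K] (f : K × K → ZMod 2) (a z : K × K) :
    derivLinearPart f a z = derivLinearPart f z a := by
  unfold derivLinearPart
  rw [add_comm z a]; ring

theorem apply_add_eq {K : Type*} [Field K] (f : K × K → ZMod 2) (a z : K × K) :
    f z + f (z + a) = f a + f 0 + derivLinearPart f a z := by
  unfold derivLinearPart
  have := CharTwo.add_self_eq_zero (f a + f 0)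
  linear_combination - this

/-! ### Walsh transform and the radical of the derivative form -/

section

variable {K : Type*} [Field K] [Fintype K] [Algebra (ZMod 2) K]

/-- The radical of the symmetric form attached to a quadratic Boolean function. -/
def radical (f : K × K → ZMod 2)
    (h : ∀ a z w, derivLinearPart f a (z + w) = derivLinearPart f a z + derivLinearPart f a w) :
    Submodule (ZMod 2) (K × K) :=
  AddSubgroup.toZModSubmodule 2
    { carrier := {a | ∀ z, derivLinearPart f a z = 0}
      add_mem' := fun {a b} ha hb z => by
        rw [derivLinearPart_comm, h, derivLinearPart_comm f z a, derivLinearPart_comm f z b,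
          ha z, hb z, add_zero]
      zero_mem' := fun z => by
        have := h z 0 0
        rw [add_zero] at this
        rw [derivLinearPart_comm]
        exact left_eq_add.mp this
      neg_mem' := fun {a} ha z => by
        have : -a = a := by
          rw [neg_eq_iff_add_eq_zero, ← two_nsmul, ← Nat.cast_smul_eq_nsmul (ZMod 2)]
          simp [show (2 : ZMod 2) = 0 from rfl]
        rw [this]; exact ha z }

theorem mem_radical {f : K × K → ZMod 2}
    {h : ∀ a z w, derivLinearPart f a (z + w) = derivLinearPart f a z + derivLinearPart f a w}
    {a : K × K} : a ∈ radical f h ↔ ∀ z, derivLinearPart f a z = 0 := Iff.rfl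

theorem traceInner_add_left (a b w : K × K) :
    traceInner (a + b) w = traceInner a w + traceInner b w := by
  simp only [traceInner, ← map_add]; congr 1; simp; ring

theorem traceInner_add_right (a b w : K × K) :
    traceInner w (a + b) = traceInner w a + traceInner w b := by
  simp only [traceInner, ← map_add]; congr 1; simp; ring

theorem exists_trace_mul_ne_zero {a : K} (ha : a ≠ 0) :
    ∃ b : K, Algebra.trace (ZMod 2) K (a * b) ≠ 0 := by
  by_contra! h
  exact ha ((traceForm_nondegenerate (ZMod 2) K).1 a h)

theorem exists_traceInner_ne_zero {z : K × K} (hz : z ≠ 0) : ∃ w, traceInner z w ≠ 0 := by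
  by_cases h : z.1 = 0
  · have h2 : z.2 ≠ 0 := fun h2 => hz (Prod.ext h h2)
    obtain ⟨b, hb⟩ := exists_trace_mul_ne_zero h2
    exact ⟨(0, b), by simpa [traceInner] using hb⟩
  · obtain ⟨b, hb⟩ := exists_trace_mul_ne_zero h
    exact ⟨(b, 0), by simpa [traceInner] using hb⟩

/-- By orthogonality, summing the transform over all w leaves only the term z = 0, which is nonzero.
-/
theorem exists_walsh_ne_zero (f : K × K → ZMod 2) : ∃ w, walsh f w ≠ 0 := by
  classical
  by_contra! h
  have h1 : ∑ w : K × K, walsh f w = 0 := Finset.sum_eq_zero fun w _ => h w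
  simp only [walsh, neg_one_pow_val_add] at h1
  rw [Finset.sum_comm, Finset.sum_eq_single 0] at h1
  · simp [traceInner] at h1
  · intro z _ hz
    rw [← Finset.mul_sum, sum_neg_one_pow_eq_zero _ (fun a b => traceInner_add_right a b z)
      (exists_traceInner_ne_zero hz), mul_zero]
  · simp

theorem walsh_sq (f : K × K → ZMod 2)
    (h : ∀ a z w, derivLinearPart f a (z + w) = derivLinearPart f a z + derivLinearPart f a w)
    (w : K × K) :
    walsh f w ^ 2 = 0 ∨
      walsh f w ^ 2 = 2 ^ (Module.finrank (ZMod 2) (K × K) + Module.finrank (ZMod 2) (radical f h)) := by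
  classical
  have hcard : ∀ (M : Type _) [AddCommGroup M] [Module (ZMod 2) M] [Fintype M],
      Fintype.card M = 2 ^ Module.finrank (ZMod 2) M := fun M _ _ _ => by
    simpa using Module.card_eq_pow_finrank (K := ZMod 2) (V := M)
  -- Substituting y = z + a in the double sum separates the part depending on a alone from the
  -- derivative.
  have h1 : walsh f w ^ 2 = ∑ a : K × K, (-1 : ℤ) ^ (f a + f 0 + traceInner a w).val *
      ∑ z : K × K, (-1 : ℤ) ^ (derivLinearPart f a z).val := by
    rw [sq, walsh, Finset.sum_mul_sum]
    have : ∀ z : K × K, ∑ y : K × K, (-1 : ℤ) ^ (f z + traceInner z w).val *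
        (-1) ^ (f y + traceInner y w).val =
        ∑ a : K × K, (-1 : ℤ) ^ (f z + traceInner z w).val *
        (-1) ^ (f (z + a) + traceInner (z + a) w).val := fun z =>
      (Equiv.sum_comp (Equiv.addLeft z) fun y => (-1 : ℤ) ^ (f z + traceInner z w).val *
        (-1) ^ (f y + traceInner y w).val).symm
    simp_rw [this]
    rw [Finset.sum_comm]
    refine Finset.sum_congr rfl fun a _ => ?_
    rw [Finset.mul_sum]
    refine Finset.sum_congr rfl fun z _ => ?_
    rw [← neg_one_pow_val_add, ← neg_one_pow_val_add]
    congr 2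
    rw [traceInner_add_left]
    have e1 := apply_add_eq f a z
    have e2 := CharTwo.add_self_eq_zero (traceInner z w)
    linear_combination e1 + e2
  have h2 : walsh f w ^ 2 = Fintype.card (K × K) *
      ∑ a : radical f h, (-1 : ℤ) ^ (f a + f 0 + traceInner (a : K × K) w).val := by
    rw [h1, Finset.mul_sum, ← Finset.sum_subset (Finset.subset_univ
      (Finset.univ.filter fun a : K × K => a ∈ radical f h))]
    · rw [Finset.sum_subtype (Finset.univ.filter fun a : K × K => a ∈ radical f h)
        (p := fun a => a ∈ radical f h) (by simp)]
      refine Finset.sum_congr rfl fun a _ => ?_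
      have : ∀ z, derivLinearPart f a z = 0 := a.2
      simp [this, mul_comm]
    · intro a _ ha
      have ha' : ∃ z, derivLinearPart f a z ≠ 0 := by simpa [mem_radical] using ha
      rw [sum_neg_one_pow_eq_zero _ (h a) ha', mul_zero]
  -- On the radical the remaining exponent is additive, so its character sum is 0 or the size of the
  -- radical.
  have hadd : ∀ a b : radical f h, f ((a + b : radical f h) : K × K) + f 0 +
      traceInner ((a + b : radical f h) : K × K) w =
      (f a + f 0 + traceInner (a : K × K) w) + (f b + f 0 + traceInner (b : K × K) w) := by
    intro a b
    have e := apply_add_eq f (b : K × K) a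
    rw [derivLinearPart_comm, b.2 a |> (derivLinearPart_comm f a b).trans] at e
    rw [Submodule.coe_add, traceInner_add_left]
    have e2 := CharTwo.add_self_eq_zero (f (a : K × K))
    linear_combination e - e2
  by_cases h3 : ∃ a : radical f h, f a + f 0 + traceInner (a : K × K) w ≠ 0
  · left
    rw [h2, sum_neg_one_pow_eq_zero _ hadd h3, mul_zero]
  · right
    push Not at h3
    rw [h2]
    simp only [h3, ZMod.val_zero, pow_zero, Finset.sum_const, Finset.card_univ, nsmul_eq_mul, mul_one]
    rw [hcard, hcard, pow_add]
    push_cast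
    rfl

theorem isPlateaued_radical (f : K × K → ZMod 2)
    (h : ∀ a z w, derivLinearPart f a (z + w) = derivLinearPart f a z + derivLinearPart f a w) :
    IsPlateaued f (Module.finrank (ZMod 2) (radical f h)) := by
  have hev : Even (Module.finrank (ZMod 2) (K × K) + Module.finrank (ZMod 2) (radical f h)) := by
    obtain ⟨w, hw⟩ := exists_walsh_ne_zero f
    have h1 := (walsh_sq f h w).resolve_left (pow_ne_zero 2 hw)
    generalize Module.finrank (ZMod 2) (K × K) + Module.finrank (ZMod 2) (radical f h) = N at h1
    have h2 : (walsh f w).natAbs ^ 2 = 2 ^ N := by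
      zify; rw [sq_abs]; exact h1
    have h3 := congrArg (fun x => x.factorization 2) h2
    -- Comparing 2-adic valuations: a square equal to 2 ^ N forces N to be even.
    simp only [Nat.factorization_pow, Finsupp.smul_apply, smul_eq_mul,
      Nat.Prime.factorization_self Nat.prime_two, mul_one] at h3
    exact ⟨_, by rw [← h3]; ring⟩
  refine ⟨hev, fun w => ?_⟩
  obtain ⟨r, hr⟩ := hev
  rcases walsh_sq f h w with h1 | h1
  · left; simpa using h1
  · right
    rw [hr] at h1 ⊢
    have e : (r + r) / 2 = r := by omega
    rw [e]
    rw [← two_mul, mul_comm, pow_mul] at h1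
    simpa using sq_eq_sq_iff_eq_or_eq_neg.mp h1

theorem charP_two (K : Type*) [Field K] [Algebra (ZMod 2) K] : CharP K 2 :=
  charP_of_injective_algebraMap (algebraMap (ZMod 2) K).injective 2

theorem derivLinearPart_additive {f : K × K → ZMod 2} {A B : MvPolynomial (Fin 2) K}
    (hAB : RepresentsDeriv f A B) (a z w : K × K) :
    derivLinearPart f a (z + w) = derivLinearPart f a z + derivLinearPart f a w := by
  have := charP_two K
  obtain ⟨δ₁, δ₂, H⟩ := hAB
  rw [← Prod.mk.eta (p := a), ← Prod.mk.eta (p := z), ← Prod.mk.eta (p := w), Prod.mk_add_mk,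
    H, H, H, ← map_add, add_pow_char_pow, add_pow_char_pow]
  congr 1; ring

/-- The powers x ^ (2 ^ δ) exhaust K, so the exponents δ₁, δ₂ do not matter; taking x or y to be 0
isolates each coefficient, and nondegeneracy of the trace form kills it. -/
theorem mem_radical_iff_of_representsDeriv {f : K × K → ZMod 2} {A B : MvPolynomial (Fin 2) K}
    (hAB : RepresentsDeriv f A B) (a : K × K) :
    a ∈ radical f (derivLinearPart_additive hAB) ↔
      eval ![a.1, a.2] A = 0 ∧ eval ![a.1, a.2] B = 0 := by
  have := charP_two K
  rw [mem_radical]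
  obtain ⟨δ₁, δ₂, H⟩ := hAB
  have surj : ∀ (δ : ℕ) (b : K), ∃ x : K, x ^ 2 ^ δ = b := fun δ b =>
    (iterateFrobeniusEquiv K 2 δ).surjective b
  constructor
  · intro h
    constructor
    · by_contra h0
      obtain ⟨b, hb⟩ := exists_trace_mul_ne_zero h0
      obtain ⟨x, rfl⟩ := surj δ₁ b
      have := h (x, 0)
      rw [← Prod.mk.eta (p := a), H] at this
      exact hb (by simpa using this)
    · by_contra h0
      obtain ⟨b, hb⟩ := exists_trace_mul_ne_zero h0
      obtain ⟨x, rfl⟩ := surj δ₂ b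
      have := h (0, x)
      rw [← Prod.mk.eta (p := a), H] at this
      exact hb (by simpa using this)
  · rintro ⟨h1, h2⟩ z
    rw [← Prod.mk.eta (p := a), ← Prod.mk.eta (p := z), H, h1, h2]
    simp

end

/-! ### Linearized polynomials in two variables -/

section

variable {K : Type*} [Field K]

/-- The linearized polynomial with coefficients `c i` at `X ^ (2 ^ (i * k))` and `e i` at
`Y ^ (2 ^ (i * k))`, for `i < n`. -/
def linPoly (k : ℕ) (c e : ℕ → K) (n : ℕ) : MvPolynomial (Fin 2) K :=
  ∑ i ∈ Finset.range n, (C (c i) * X 0 ^ (2 ^ (i * k)) + C (e i) * X 1 ^ (2 ^ (i * k)))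

theorem linPoly_congr {k n n' : ℕ} {c e c' e' : ℕ → K} (hc : ∀ i < n, c i = c' i)
    (he : ∀ i < n, e i = e' i) (hn : n ≤ n') (hc' : ∀ i, n ≤ i → c' i = 0)
    (he' : ∀ i, n ≤ i → e' i = 0) : linPoly k c e n = linPoly k c' e' n' := by
  unfold linPoly
  rw [← Finset.sum_subset (Finset.range_subset_range.mpr hn)]
  · refine Finset.sum_congr rfl fun i hi => ?_
    rw [hc i (Finset.mem_range.mp hi), he i (Finset.mem_range.mp hi)]
  · intro i _ hi
    have : n ≤ i := by simpa using hi
    simp [hc' i this, he' i this]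

theorem coeff_linPoly {k : ℕ} (hk : k ≠ 0) (c e : ℕ → K) {n i : ℕ} (hi : i < n) :
    coeff (Finsupp.single 0 (2 ^ (i * k))) (linPoly k c e n) = c i ∧
      coeff (Finsupp.single 1 (2 ^ (i * k))) (linPoly k c e n) = e i := by
  classical
  have h2 : ∀ a b : ℕ, 2 ^ (a * k) = 2 ^ (b * k) ↔ a = b := fun a b => by
    rw [Nat.pow_right_inj (by norm_num), Nat.mul_left_inj hk]
  have h3 : ∀ a b : ℕ, (Finsupp.single (0 : Fin 2) (2 ^ (a * k)) : Fin 2 →₀ ℕ) ≠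
      Finsupp.single 1 (2 ^ (b * k)) := fun a b h => by
    have := DFunLike.congr_fun h 0
    simp at this
  simp only [linPoly, coeff_sum, coeff_add, coeff_C_mul, coeff_X_pow]
  constructor
  · rw [Finset.sum_eq_single i]
    · simp [(h3 _ _).symm]
    · intro b _ hb
      have : ¬ (Finsupp.single (0 : Fin 2) (2 ^ (b * k)) = Finsupp.single 0 (2 ^ (i * k))) :=
        fun h => hb ((h2 _ _).mp (Finsupp.single_injective _ h))
      simp [(h3 _ _).symm, this]
    · simp [hi]
  · rw [Finset.sum_eq_single i]
    · simp [(h3 _ _)]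
    · intro b _ hb
      have : ¬ (Finsupp.single (1 : Fin 2) (2 ^ (b * k)) = Finsupp.single 1 (2 ^ (i * k))) :=
        fun h => hb ((h2 _ _).mp (Finsupp.single_injective _ h))
      simp [(h3 _ _), this]
    · simp [hi]

/-- The degree kills all coefficients of index beyond d, whatever length the given expression has.
Leaving n free allows A and B to be written with a common length. -/
theorem exists_eq_linPoly {k d : ℕ} (hk : k ≠ 0) {p : MvPolynomial (Fin 2) K}
    (hp : IsLinearized k p) (hd : p.totalDegree = 2 ^ (k * d)) :
    ∃ c e : ℕ → K, ∀ n, d < n → p = linPoly k c e n := by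
  obtain ⟨N, c, e, h⟩ := hp
  set c' : ℕ → K := fun i => if i < N + 1 then c i else 0
  set e' : ℕ → K := fun i => if i < N + 1 then e i else 0
  have h1 : ∀ n, N + 1 ≤ n → p = linPoly k c' e' n := by
    intro n hn
    rw [h]
    exact linPoly_congr (fun i hi => (if_pos hi).symm) (fun i hi => (if_pos hi).symm) hn
      (fun i hi => if_neg hi.not_gt) (fun i hi => if_neg hi.not_gt)
  have hlt : ∀ i, d < i → ∀ j : Fin 2, coeff (Finsupp.single j (2 ^ (i * k))) p = 0 := by
    intro i hi j
    apply coeff_eq_zero_of_totalDegree_lt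
    rw [hd]
    have : k * d < i * k := by
      rw [mul_comm]; exact Nat.mul_lt_mul_of_pos_right hi (Nat.pos_of_ne_zero hk)
    have := Nat.pow_lt_pow_right (a := 2) (by norm_num) this
    rw [Finset.sum_eq_single j (fun b _ hb => by simp [hb.symm]) (by simp)]
    simpa using this
  have hc : ∀ i, d < i → c' i = 0 := fun i hi => by
    rw [← (coeff_linPoly hk c' e' (n := N + 1 + i + 1) (i := i) (by omega)).1, ← h1 _ (by omega)]
    exact hlt i hi 0
  have he : ∀ i, d < i → e' i = 0 := fun i hi => by
    rw [← (coeff_linPoly hk c' e' (n := N + 1 + i + 1) (i := i) (by omega)).2, ← h1 _ (by omega)]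
    exact hlt i hi 1
  refine ⟨c', e', fun n hn => ?_⟩
  rw [h1 (N + 1 + n) (by omega)]
  exact (linPoly_congr (fun _ _ => rfl) (fun _ _ => rfl) (by omega) (fun i hi => hc i (by omega))
    (fun i hi => he i (by omega))).symm

/-- The space of linearized polynomials with exponents `2 ^ (i * k)`, `i < n`. -/
def linSpace (K : Type*) [Field K] (k n : ℕ) : Submodule K (MvPolynomial (Fin 2) K) :=
  Submodule.span K (Set.range (Sum.elim (fun i : Fin n => (X 0 ^ (2 ^ (i.1 * k)) : MvPolynomial (Fin 2) K))
    (fun i : Fin n => X 1 ^ (2 ^ (i.1 * k)))))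

theorem X_zero_pow_mem_linSpace {k n i : ℕ} (hi : i < n) :
    (X 0 ^ (2 ^ (i * k)) : MvPolynomial (Fin 2) K) ∈ linSpace K k n :=
  Submodule.subset_span ⟨Sum.inl ⟨i, hi⟩, rfl⟩

theorem X_one_pow_mem_linSpace {k n i : ℕ} (hi : i < n) :
    (X 1 ^ (2 ^ (i * k)) : MvPolynomial (Fin 2) K) ∈ linSpace K k n :=
  Submodule.subset_span ⟨Sum.inr ⟨i, hi⟩, rfl⟩

theorem linPoly_mem_linSpace (k : ℕ) (c e : ℕ → K) {n n' : ℕ} (h : n ≤ n') :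
    linPoly k c e n ∈ linSpace K k n' := by
  refine Submodule.sum_mem _ fun i hi => ?_
  have : i < n' := (Finset.mem_range.mp hi).trans_le h
  rw [← smul_eq_C_mul, ← smul_eq_C_mul]
  exact add_mem (Submodule.smul_mem _ _ (X_zero_pow_mem_linSpace this))
    (Submodule.smul_mem _ _ (X_one_pow_mem_linSpace this))

/-- Raising to a power of 2 is additive, and shifts each index by j. -/
theorem pow_mem_linSpace [CharP K 2] {k n : ℕ} (j : ℕ) {T : MvPolynomial (Fin 2) K}
    (hT : T ∈ linSpace K k n) {n' : ℕ} (h : n + j ≤ n') : T ^ (2 ^ (j * k)) ∈ linSpace K k n' := by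
  induction hT using Submodule.span_induction with
  | mem x hx =>
    obtain ⟨i | i, rfl⟩ := hx
    · simp only [Sum.elim_inl, ← pow_mul, ← pow_add, ← add_mul]
      exact X_zero_pow_mem_linSpace (by omega)
    · simp only [Sum.elim_inr, ← pow_mul, ← pow_add, ← add_mul]
      exact X_one_pow_mem_linSpace (by omega)
  | zero => rw [zero_pow (by positivity)]; exact zero_mem _
  | add x y _ _ hx hy => rw [add_pow_char_pow]; exact add_mem hx hy
  | smul a x _ hx => rw [smul_pow]; exact Submodule.smul_mem _ _ hx

instance (k n : ℕ) : FiniteDimensional K (linSpace K k n) :=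
  FiniteDimensional.span_of_finite K (Set.finite_range _)

theorem finrank_linSpace_le (k n : ℕ) : Module.finrank K (linSpace K k n) ≤ 2 * n := by
  refine (finrank_range_le_card _).trans ?_
  simp [two_mul]

/-! ### Independence of the powers of two coprime polynomials -/

/-- The powers `A ^ (2 ^ (i * k))` and `B ^ (2 ^ (i * k))`. -/
def powFamily (k : ℕ) (A B : MvPolynomial (Fin 2) K) : ℕ ⊕ ℕ → MvPolynomial (Fin 2) K :=
  Sum.elim (fun i => A ^ (2 ^ (i * k))) (fun i => B ^ (2 ^ (i * k)))

theorem exists_prime_dvd_of_eval_eq_zero {A : MvPolynomial (Fin 2) K} (hA : A ≠ 0)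
    (h0 : eval 0 A = 0) : ∃ p, Prime p ∧ p ∣ A ∧ eval 0 p = 0 := by
  obtain ⟨s, hs, hsA⟩ := UniqueFactorizationMonoid.exists_prime_factors A hA
  have h1 : eval 0 s.prod = 0 := by
    obtain ⟨u, rfl⟩ := hsA
    rw [map_mul] at h0
    exact (mul_eq_zero.mp h0).resolve_right ((u.isUnit.map (eval 0)).ne_zero)
  rw [map_multiset_prod, Multiset.prod_eq_zero_iff] at h1
  obtain ⟨p, hp, hp0⟩ := Multiset.mem_map.mp h1
  exact ⟨p, hs p hp, (Multiset.dvd_prod hp).trans hsA.dvd, hp0⟩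

/-- With j the lowest index present, the sum factors as A ^ (2 ^ (jk)) (p j + A R). The second
factor is nonzero at the origin, where π vanishes, so π must divide the first. -/
theorem dvd_of_dvd_sum {k N j : ℕ} (hk : k ≠ 0) {A π : MvPolynomial (Fin 2) K} (hπ : Prime π)
    (hπ0 : eval 0 π = 0) (hA0 : eval 0 A = 0) {p : ℕ → K} (hj : j < N) (hp : ∀ i < j, p i = 0)
    (hpj : p j ≠ 0) (h : π ∣ ∑ i ∈ Finset.range N, C (p i) * A ^ (2 ^ (i * k))) : π ∣ A := by
  have h1 : A ^ (2 ^ (j * k) + 1) ∣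
      ∑ i ∈ (Finset.range N).erase j, C (p i) * A ^ (2 ^ (i * k)) := by
    refine Finset.dvd_sum fun i hi => ?_
    rcases lt_or_ge i j with hij | hij
    · simp [hp i hij]
    · have : j < i := lt_of_le_of_ne hij (Finset.ne_of_mem_erase hi).symm
      refine (pow_dvd_pow A ?_).mul_left _
      exact Nat.pow_lt_pow_right (by norm_num)
        (Nat.mul_lt_mul_of_pos_right this (Nat.pos_of_ne_zero hk))
  obtain ⟨R, hR⟩ := h1
  rw [← Finset.add_sum_erase _ _ (Finset.mem_range.mpr hj), hR,
    show C (p j) * A ^ (2 ^ (j * k)) + A ^ (2 ^ (j * k) + 1) * R =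
      A ^ (2 ^ (j * k)) * (C (p j) + A * R) by ring] at h
  rcases hπ.dvd_or_dvd h with h | h
  · exact hπ.dvd_of_dvd_pow h
  · obtain ⟨S, hS⟩ := h
    have := congrArg (eval 0) hS
    simp only [map_add, map_mul, eval_C, hA0, hπ0, zero_mul, add_zero] at this
    exact absurd this hpj

/-- In a relation, the A-part is minus the B-part, so a prime factor of B through the origin divides
the A-part. A nonzero coefficient there would make it divide A as well, against coprimality. The
roles of A and B are symmetric. -/
theorem linearIndependent_powFamily {k : ℕ} (hk : k ≠ 0) {A B : MvPolynomial (Fin 2) K}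
    (hA : A ≠ 0) (hB : B ≠ 0) (hA0 : eval 0 A = 0) (hB0 : eval 0 B = 0) (hcop : IsRelPrime A B) :
    LinearIndependent K (powFamily k A B) := by
  have dv : ∀ (D : MvPolynomial (Fin 2) K) (r : ℕ → K) (N : ℕ),
      D ∣ ∑ i ∈ Finset.range N, C (r i) * D ^ (2 ^ (i * k)) := fun D r N =>
    Finset.dvd_sum fun i _ => (dvd_pow_self D (by positivity)).mul_left _
  have key : ∀ (p q : ℕ → K) (N : ℕ), ∑ i ∈ Finset.range N, C (p i) * A ^ (2 ^ (i * k)) +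
      ∑ i ∈ Finset.range N, C (q i) * B ^ (2 ^ (i * k)) = 0 → ∀ i < N, p i = 0 ∧ q i = 0 := by
    intro p q N h i
    induction i using Nat.strong_induction_on with
    | _ i ih =>
      intro hi
      have ihp : ∀ j < i, p j = 0 := fun j hj => (ih j hj (hj.trans hi)).1
      have ihq : ∀ j < i, q j = 0 := fun j hj => (ih j hj (hj.trans hi)).2
      constructor
      · by_contra hp
        obtain ⟨π, hπ, hπB, hπ0⟩ := exists_prime_dvd_of_eval_eq_zero hB hB0
        refine hπ.not_isUnit (hcop (dvd_of_dvd_sum hk hπ hπ0 hA0 hi ihp hp ?_) hπB)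
        rw [eq_neg_of_add_eq_zero_left h, dvd_neg]
        exact hπB.trans (dv _ _ _)
      · by_contra hq
        obtain ⟨π, hπ, hπA, hπ0⟩ := exists_prime_dvd_of_eval_eq_zero hA hA0
        refine hπ.not_isUnit (hcop hπA (dvd_of_dvd_sum hk hπ hπ0 hB0 hi ihq hq ?_))
        rw [eq_neg_of_add_eq_zero_right h, dvd_neg]
        exact hπA.trans (dv _ _ _)
  rw [linearIndependent_iff']
  intro s g hs
  obtain ⟨N, hN⟩ : ∃ N, s ⊆ (Finset.range N).disjSum (Finset.range N) := by
    refine ⟨(s.sup (Sum.elim id id)) + 1, fun i hi => ?_⟩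
    have := Finset.le_sup (f := Sum.elim id id) hi
    rcases i with i | i <;> simpa [Nat.lt_succ_iff] using this
  classical
  set g' : ℕ ⊕ ℕ → K := fun i => if i ∈ s then g i else 0
  have h1 : ∑ i ∈ (Finset.range N).disjSum (Finset.range N), g' i • powFamily k A B i = 0 := by
    rw [← hs, ← Finset.sum_subset hN]
    · exact Finset.sum_congr rfl fun i hi => by simp [g', hi]
    · intro i _ hi; simp [g', hi]
  rw [Finset.sum_disjSum] at h1
  simp only [powFamily, Sum.elim_inl, Sum.elim_inr, smul_eq_C_mul] at h1
  have h2 := key (fun i => g' (Sum.inl i)) (fun i => g' (Sum.inr i)) N h1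
  intro i hi
  have h3 : g' i = 0 := by
    have := hN hi
    rcases i with i | i
    · exact (h2 i (by simpa using this)).1
    · exact (h2 i (by simpa using this)).2
  simpa [g', hi] using h3

theorem LinearIndependent.eq_zero_of_smul_add_smul_mem_span {ι M : Type*} [AddCommGroup M]
    [Module K M] {u : ι → M} (hu : LinearIndependent K u) {s : Set ι} {i j : ι} (hij : i ≠ j)
    (hi : i ∉ s) (hj : j ∉ s) {α β : K} (h : α • u i + β • u j ∈ Submodule.span K (u '' s)) :
    α = 0 ∧ β = 0 := by
  classical
  rw [Finsupp.span_image_eq_map_linearCombination] at h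
  obtain ⟨f, hf, hfe⟩ := h
  have h1 : f = Finsupp.single i α + Finsupp.single j β := by
    apply hu
    rw [hfe]; simp
  have hz : ∀ x, x ∉ s → f x = 0 := fun x hx => by
    by_contra h0
    exact hx (hf (Finsupp.mem_support_iff.mpr h0))
  have e1 := hz i hi
  have e2 := hz j hj
  rw [h1] at e1 e2
  exact ⟨by simpa [hij, hij.symm] using e1, by simpa [hij, hij.symm] using e2⟩

end

/-! ### Dimension count by evaluation at the common zeros -/

section

variable {K : Type*} [Field K] [Fintype K] [Algebra (ZMod 2) K]

/-- Coprimality makes the k-th power of Frobenius a generator of the Galois group. Its m distinct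
powers are independent over K by Dedekind, and the space of 𝔽₂-endomorphisms of K has K-dimension m.
-/
theorem exists_eq_sum_frobenius {m k : ℕ} (hm : Module.finrank (ZMod 2) K = m)
    (hk : Nat.gcd k m = 1) (g : K →ₗ[ZMod 2] K) :
    ∃ c : ℕ → K, ∀ x, g x = ∑ i ∈ Finset.range m, c i * x ^ (2 ^ (i * k)) := by
  set φ := FiniteField.frobeniusAlgHom (ZMod 2) K
  have hφ : ∀ (j : ℕ) (x : K), (φ ^ j) x = x ^ 2 ^ j := by
    intro j x
    induction j with
    | zero => simp
    | succ j ih =>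
      rw [pow_succ', AlgHom.mul_apply, ih]
      simp [φ, FiniteField.frobeniusAlgHom, pow_succ, pow_mul]
  have hord : orderOf (φ ^ k) = m := by
    have h1 : orderOf φ = m := (FiniteField.orderOf_frobeniusAlgHom _ _).trans hm
    rw [Nat.Coprime.orderOf_pow (by rw [h1]; exact Nat.Coprime.symm hk), h1]
  have hli : LinearIndependent K (fun i : Fin m => ((φ ^ k) ^ i.1).toLinearMap) := by
    refine (linearIndependent_toLinearMap (ZMod 2) K K).comp (fun i : Fin m => (φ ^ k) ^ i.1) ?_
    intro i j hij
    exact Fin.ext (pow_injOn_Iio_orderOf (by simp [hord]) (by simp [hord]) hij)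
  have hspan := hli.span_eq_top_of_card_eq_finrank' (by simp [Module.finrank_linearMap, hm])
  have hg : g ∈ Submodule.span K (Set.range fun i : Fin m => ((φ ^ k) ^ i.1).toLinearMap) := by
    rw [hspan]; trivial
  obtain ⟨c, hc⟩ := (Submodule.mem_span_range_iff_exists_fun K).mp hg
  refine ⟨fun i => if h : i < m then c ⟨i, h⟩ else 0, fun x => ?_⟩
  rw [← hc, Finset.sum_range]
  simp [LinearMap.sum_apply, ← pow_mul, hφ, mul_comm k]

/-- Evaluation of polynomials on a set of points of the plane. -/
def evalOn (Z : Submodule (ZMod 2) (K × K)) : MvPolynomial (Fin 2) K →ₗ[K] (Z → K) :=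
  LinearMap.pi fun z => (aeval ![z.1.1, z.1.2]).toLinearMap

theorem evalOn_apply (Z : Submodule (ZMod 2) (K × K)) (p : MvPolynomial (Fin 2) K) (z : Z) :
    evalOn Z p z = eval ![z.1.1, z.1.2] p := by
  simp [evalOn, aeval_eq_eval]

theorem finrank_add_finrank_le {m k n : ℕ} (hm : Module.finrank (ZMod 2) K = m)
    (hk : Nat.gcd k m = 1) (hn : m ≤ n) (Z : Submodule (ZMod 2) (K × K))
    {W : Submodule K (MvPolynomial (Fin 2) K)} (hW : W ≤ linSpace K k n)
    (hWZ : ∀ p ∈ W, ∀ z ∈ Z, eval ![z.1, z.2] p = 0) :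
    Module.finrank K W + Module.finrank (ZMod 2) Z ≤ 2 * n := by
  have h1 : LinearMap.range (LinearMap.ltoFun (ZMod 2) Z K K) ≤
      (linSpace K k n).map (evalOn Z) := by
    rintro _ ⟨g, rfl⟩
    -- Extend the map from Z to K × K and represent each coordinate separately; m terms suffice, and
    -- m ≤ n.
    obtain ⟨g', hg'⟩ := LinearMap.exists_extend g
    obtain ⟨c, hc⟩ := exists_eq_sum_frobenius hm hk (g' ∘ₗ LinearMap.inl (ZMod 2) K K)
    obtain ⟨e, he⟩ := exists_eq_sum_frobenius hm hk (g' ∘ₗ LinearMap.inr (ZMod 2) K K)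
    refine ⟨linPoly k c e m, linPoly_mem_linSpace k c e hn, ?_⟩
    ext z
    have e1 : g z = g' (z.1.1, 0) + g' (0, z.1.2) := by
      rw [← map_add, ← hg']; simp
    have hc' := hc z.1.1
    have he' := he z.1.2
    simp only [LinearMap.comp_apply, LinearMap.inl_apply, LinearMap.inr_apply] at hc' he'
    rw [evalOn_apply]
    simp only [LinearMap.ltoFun_apply]
    rw [e1, hc', he']
    simp [linPoly, Finset.sum_add_distrib]
  have h2 : Module.finrank (ZMod 2) Z ≤ Module.finrank K ((linSpace K k n).map (evalOn Z)) := by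
    refine le_trans (le_of_eq ?_) (Submodule.finrank_mono h1)
    rw [LinearMap.finrank_range_of_inj (fun a b h => LinearMap.ext fun x => congrFun h x)]
    simp [Module.finrank_linearMap]
  have h3 := LinearMap.finrank_range_add_finrank_ker ((evalOn Z).domRestrict (linSpace K k n))
  rw [LinearMap.range_domRestrict] at h3
  have h4 : Module.finrank K W ≤
      Module.finrank K (LinearMap.ker ((evalOn Z).domRestrict (linSpace K k n))) := by
    rw [← LinearEquiv.finrank_eq (Submodule.comapSubtypeEquivOfLe hW)]
    refine Submodule.finrank_mono fun p hp => ?_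
    ext z
    simp only [LinearMap.domRestrict_apply, evalOn_apply]
    exact hWZ p.1 hp z.1 z.2
  have := finrank_linSpace_le (K := K) k n
  omega

end

/-! ### A Jacobian criterion for intersection multiplicity at most one -/

section

variable {L : Type*} [Field L]

/-- The ideal of the point `P` of the plane. -/
def pointIdeal (P : Fin 2 → L) : Ideal (MvPolynomial (Fin 2) L) :=
  Ideal.span {X 0 - C (P 0), X 1 - C (P 1)}

theorem taylor_mem_pointIdeal_mul (P : Fin 2 → L) (f : MvPolynomial (Fin 2) L) :
    f - (C (eval P f) + C (eval P (pderiv 0 f)) * (X 0 - C (P 0)) +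
      C (eval P (pderiv 1 f)) * (X 1 - C (P 1))) ∈ pointIdeal P * pointIdeal P := by
  have hX : ∀ i : Fin 2, X i - C (P i) ∈ pointIdeal P := by
    intro i
    fin_cases i
    · exact Ideal.subset_span (by simp)
    · exact Ideal.subset_span (by simp)
  induction f using MvPolynomial.induction_on with
  | C a => simp
  | add p q hp hq =>
    have := add_mem hp hq
    simp only [map_add]
    convert this using 1
    ring
  | mul_X p i hp =>
    have h1 := Ideal.mul_mem_right (X i) _ hp
    have h2 := Ideal.mul_mem_left (pointIdeal P * pointIdeal P) (C (eval P (pderiv 0 p)))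
      (Ideal.mul_mem_mul (hX 0) (hX i))
    have h3 := Ideal.mul_mem_left (pointIdeal P * pointIdeal P) (C (eval P (pderiv 1 p)))
      (Ideal.mul_mem_mul (hX 1) (hX i))
    have := add_mem (add_mem h1 h2) h3
    convert this using 1
    fin_cases i <;> simp [pderiv_X] <;> ring

theorem ker_eval_eq_pointIdeal (P : Fin 2 → L) : RingHom.ker (eval P) = pointIdeal P := by
  apply le_antisymm
  · intro f hf
    have h0 : eval P f = 0 := hf
    have h1 := Ideal.mul_le_left (taylor_mem_pointIdeal_mul P f)
    rw [h0, C_0, zero_add] at h1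
    have h2 : C (eval P (pderiv 0 f)) * (X 0 - C (P 0)) +
        C (eval P (pderiv 1 f)) * (X 1 - C (P 1)) ∈ pointIdeal P :=
      add_mem (Ideal.mul_mem_left _ _ (Ideal.subset_span (by simp)))
        (Ideal.mul_mem_left _ _ (Ideal.subset_span (by simp)))
    simpa using add_mem h1 h2
  · refine Ideal.span_le.mpr ?_
    rintro _ (rfl | rfl) <;> simp [RingHom.mem_ker]

/-- Modulo the square of the point ideal, f and g are their linear parts; Cramer's rule recovers the
two generators. -/
theorem pointIdeal_le_sup_of_jacobian_ne_zero {f g : MvPolynomial (Fin 2) L} {P : Fin 2 → L}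
    (hf : eval P f = 0) (hg : eval P g = 0)
    (hJ : eval P (pderiv 0 f) * eval P (pderiv 1 g) -
      eval P (pderiv 1 f) * eval P (pderiv 0 g) ≠ 0) :
    pointIdeal P ≤ Ideal.span {f, g} ⊔ pointIdeal P * pointIdeal P := by
  have h1 := Ideal.mem_sup_right (S := Ideal.span {f, g}) (taylor_mem_pointIdeal_mul P f)
  have h2 := Ideal.mem_sup_right (S := Ideal.span {f, g}) (taylor_mem_pointIdeal_mul P g)
  rw [hf, C_0, zero_add] at h1
  rw [hg, C_0, zero_add] at h2
  set a := eval P (pderiv 0 f)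
  set b := eval P (pderiv 1 f)
  set c := eval P (pderiv 0 g)
  set d := eval P (pderiv 1 g)
  set J := Ideal.span {f, g} ⊔ pointIdeal P * pointIdeal P
  have hfJ : f ∈ J := Ideal.mem_sup_left (Ideal.subset_span (by simp))
  have hgJ : g ∈ J := Ideal.mem_sup_left (Ideal.subset_span (by simp))
  have h1' := sub_mem hfJ h1
  have h2' := sub_mem hgJ h2
  rw [sub_sub_cancel] at h1' h2'
  have hinv : (C (a * d - b * c)⁻¹ : MvPolynomial (Fin 2) L) * (C a * C d - C b * C c) = 1 := by
    rw [← C_mul, ← C_mul, ← C_sub, ← C_mul, inv_mul_cancel₀ hJ, C_1]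
  refine Ideal.span_le.mpr ?_
  rintro _ (rfl | rfl)
  · have := Ideal.mul_mem_left J (C (a * d - b * c)⁻¹)
      (sub_mem (Ideal.mul_mem_left J (C d) h1') (Ideal.mul_mem_left J (C b) h2'))
    have e : C (a * d - b * c)⁻¹ * (C d * (C a * (X 0 - C (P 0)) + C b * (X 1 - C (P 1))) -
        C b * (C c * (X 0 - C (P 0)) + C d * (X 1 - C (P 1)))) = (X 0 - C (P 0) : MvPolynomial (Fin 2) L) := by
      linear_combination (X 0 - C (P 0)) * hinv
    rwa [e] at this
  · have := Ideal.mul_mem_left J (C (a * d - b * c)⁻¹)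
      (sub_mem (Ideal.mul_mem_left J (C a) h2') (Ideal.mul_mem_left J (C c) h1'))
    have e : C (a * d - b * c)⁻¹ * (C a * (C c * (X 0 - C (P 0)) + C d * (X 1 - C (P 1))) -
        C c * (C a * (X 0 - C (P 0)) + C b * (X 1 - C (P 1)))) = (X 1 - C (P 1) : MvPolynomial (Fin 2) L) := by
      linear_combination (X 1 - C (P 1)) * hinv
    rwa [e] at this

/-- By Nakayama, (f, g) contains the maximal ideal of the local ring, so the quotient is spanned by
1. -/
theorem affineMult_le_one {f g : MvPolynomial (Fin 2) L} {P : Fin 2 → L}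
    (hf : eval P f = 0) (hg : eval P g = 0)
    (hJ : eval P (pderiv 0 f) * eval P (pderiv 1 g) -
      eval P (pderiv 1 f) * eval P (pderiv 0 g) ≠ 0) :
    affineMult f g P ≤ 1 := by
  unfold affineMult
  set O := Localization.AtPrime (RingHom.ker (eval P))
  set N : Ideal O := Ideal.span {algebraMap (MvPolynomial (Fin 2) L) O f,
    algebraMap (MvPolynomial (Fin 2) L) O g} with hN
  have hmap : (pointIdeal P).map (algebraMap (MvPolynomial (Fin 2) L) O) =
      IsLocalRing.maximalIdeal O := by
    rw [← ker_eval_eq_pointIdeal]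
    exact Localization.AtPrime.map_eq_maximalIdeal
  have hle : IsLocalRing.maximalIdeal O ≤ N := by
    refine Submodule.le_of_le_smul_of_le_jacobson_bot (I := IsLocalRing.maximalIdeal O) ?_
      (IsLocalRing.jacobson_eq_maximalIdeal _ bot_ne_top).ge ?_
    · rw [← hmap]
      refine Ideal.FG.map ?_ _
      exact Submodule.fg_span (Set.toFinite _)
    · have := Ideal.map_mono (f := algebraMap (MvPolynomial (Fin 2) L) O)
        (pointIdeal_le_sup_of_jacobian_ne_zero hf hg hJ)
      rwa [Ideal.map_sup, Ideal.map_mul, hmap, Ideal.map_span, Set.image_pair] at this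
  rw [Cardinal.toENat_le_one, rank_le_one_iff]
  refine ⟨1, fun v => ?_⟩
  obtain ⟨x, rfl⟩ := Ideal.Quotient.mk_surjective v
  obtain ⟨p, s, rfl⟩ := IsLocalization.exists_mk'_eq (RingHom.ker (eval P)).primeCompl x
  have hs : eval P (s : MvPolynomial (Fin 2) L) ≠ 0 := s.2
  -- The scalar is the value of the fraction p / s at P.
  refine ⟨eval P p / eval P (s : MvPolynomial (Fin 2) L), ?_⟩
  have hmem : p - C (eval P p / eval P (s : MvPolynomial (Fin 2) L)) * (s : MvPolynomial (Fin 2) L) ∈ RingHom.ker (eval P) := by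
    rw [RingHom.mem_ker]
    simp only [map_sub, map_mul, eval_C]
    field_simp
    ring
  have h1 : algebraMap _ O (p - C (eval P p / eval P (s : MvPolynomial (Fin 2) L)) * (s : MvPolynomial (Fin 2) L)) ∈
      IsLocalRing.maximalIdeal O := by
    rw [← hmap, ← ker_eval_eq_pointIdeal]
    exact Ideal.mem_map_of_mem _ hmem
  have h2 : IsLocalization.mk' O p s -
      algebraMap L O (eval P p / eval P (s : MvPolynomial (Fin 2) L)) ∈ N := by
    apply hle
    have hu := IsLocalization.map_units O s
    refine ((IsLocalRing.maximalIdeal O).unit_mul_mem_iff_mem hu).mp ?_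
    convert h1 using 1
    rw [mul_sub, IsLocalization.mk'_spec' O p s, map_sub, map_mul,
      IsScalarTower.algebraMap_apply L (MvPolynomial (Fin 2) L) O, algebraMap_eq]
    ring
  have h3 := (Ideal.Quotient.eq.mpr h2).symm
  rw [← h3, Algebra.algebraMap_eq_smul_one]
  rfl

theorem eval_dehomogenization (i : Fin 3) (F : MvPolynomial (Fin 3) L) (p : Fin 2 → L) :
    eval p (dehomogenization i F) = eval (i.insertNth (α := fun _ => L) 1 p) F := by
  unfold dehomogenization
  induction F using MvPolynomial.induction_on with
  | C a => simp [algebraMap_eq]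
  | add p q hp hq => simp only [map_add, hp, hq]
  | mul_X q j hq =>
    simp only [map_mul, hq, aeval_X, eval_X]
    congr 1
    rcases Fin.eq_self_or_eq_succAbove i j with rfl | ⟨j, rfl⟩ <;> simp

theorem pderiv_dehomogenization (i : Fin 3) (j : Fin 2) (F : MvPolynomial (Fin 3) L) :
    pderiv j (dehomogenization i F) = dehomogenization i (pderiv (i.succAbove j) F) := by
  unfold dehomogenization
  induction F using MvPolynomial.induction_on with
  | C a => simp [algebraMap_eq]
  | add p q hp hq => simp only [map_add, hp, hq]
  | mul_X q l hq =>
    simp only [map_mul, aeval_X, Derivation.leibniz, smul_eq_mul, map_add, hq]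
    congr 2
    rcases Fin.eq_self_or_eq_succAbove i l with rfl | ⟨l, rfl⟩
    · simp [pderiv_X]
    · by_cases h : l = j
      · subst h; simp
      · simp [pderiv_X_of_ne h, pderiv_X_of_ne (fun h' => h (Fin.succAbove_right_injective h'))]

theorem eval_smul_of_isHomogeneous {σ : Type*} {F : MvPolynomial σ L} {n : ℕ}
    (hF : F.IsHomogeneous n) (a : L) (x : σ → L) : eval (a • x) F = a ^ n * eval x F := by
  rw [eval_eq, eval_eq, Finset.mul_sum]
  refine Finset.sum_congr rfl fun d hd => ?_
  have h1 := hF (mem_support_iff.mp hd)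
  simp only [Pi.smul_apply, smul_eq_mul, mul_pow, Finset.prod_mul_distrib]
  rw [Finset.prod_pow_eq_pow_sum]
  have : ∑ i ∈ d.support, d i = n := by
    rw [← h1, Finsupp.weight_apply, Finsupp.sum]
    simp
  rw [this]; ring

/-- At a common zero of two forms in three variables, the minor of the Jacobian matrix
belonging to `X`, `Y` controls the intersection multiplicity in every chart. -/
theorem affineMult_dehomogenization_le_one {F G : MvPolynomial (Fin 3) L} {n n' : ℕ}
    (hF : F.IsHomogeneous n) (hG : G.IsHomogeneous n') {Q : Fin 3 → L} (hFQ : eval Q F = 0)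
    (hGQ : eval Q G = 0)
    (hJ : eval Q (pderiv 0 F) * eval Q (pderiv 1 G) -
      eval Q (pderiv 1 F) * eval Q (pderiv 0 G) ≠ 0) (i : Fin 3) (hi : Q i ≠ 0) :
    affineMult (dehomogenization i F) (dehomogenization i G)
      (fun j => Q (i.succAbove j) / Q i) ≤ 1 := by
  have hpt : i.insertNth (α := fun _ => L) 1 (fun j => Q (i.succAbove j) / Q i) = (Q i)⁻¹ • Q := by
    ext l
    rcases Fin.eq_self_or_eq_succAbove i l with rfl | ⟨l, rfl⟩
    · simp [hi]
    · simp [div_eq_inv_mul]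
  -- At a common zero, Euler's identities make both gradients orthogonal to Q, so the 2 × 2 minors
  -- are proportional to the coordinates of Q up to sign. This carries the X, Y minor to the minor
  -- of any chart.
  have eF := congrArg (eval Q) hF.sum_X_mul_pderiv
  have eG := congrArg (eval Q) hG.sum_X_mul_pderiv
  simp only [Fin.sum_univ_three, map_add, map_mul, eval_X, map_nsmul, hFQ, hGQ, smul_zero] at eF eG
  apply affineMult_le_one
  · rw [eval_dehomogenization, hpt, eval_smul_of_isHomogeneous hF, hFQ, mul_zero]
  · rw [eval_dehomogenization, hpt, eval_smul_of_isHomogeneous hG, hGQ, mul_zero]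
  · simp only [pderiv_dehomogenization, eval_dehomogenization, hpt,
      eval_smul_of_isHomogeneous hF.pderiv, eval_smul_of_isHomogeneous hG.pderiv]
    have hc : (Q i)⁻¹ ^ (n - 1) * (Q i)⁻¹ ^ (n' - 1) ≠ 0 := by simp [hi]
    have hm : eval Q (pderiv (i.succAbove 0) F) * eval Q (pderiv (i.succAbove 1) G) -
        eval Q (pderiv (i.succAbove 1) F) * eval Q (pderiv (i.succAbove 0) G) ≠ 0 := by
      fin_cases i
      · change eval Q (pderiv 1 F) * eval Q (pderiv 2 G) -
          eval Q (pderiv 2 F) * eval Q (pderiv 1 G) ≠ 0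
        refine fun h => mul_ne_zero hi hJ ?_
        change Q 0 * _ = 0
        linear_combination Q 2 * h - eval Q (pderiv 1 F) * eG + eval Q (pderiv 1 G) * eF
      · change eval Q (pderiv 0 F) * eval Q (pderiv 2 G) -
          eval Q (pderiv 2 F) * eval Q (pderiv 0 G) ≠ 0
        refine fun h => mul_ne_zero hi hJ ?_
        change Q 1 * _ = 0
        linear_combination -Q 2 * h + eval Q (pderiv 0 F) * eG - eval Q (pderiv 0 G) * eF
      · exact hJ
    refine fun h => mul_ne_zero hc hm ?_
    linear_combination h

/-! ### Homogenization of linearized polynomials -/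

/-- The form `Z ^ D f (X / Z, Y / Z)`, as a linear function of `f`. -/
def homogenizationOfDegree (D : ℕ) : MvPolynomial (Fin 2) L →ₗ[L] MvPolynomial (Fin 3) L :=
  (basisMonomials (Fin 2) L).constr L fun t =>
    X 0 ^ (t 0) * X 1 ^ (t 1) * X 2 ^ (D - (t 0 + t 1))

theorem homogenization_eq (f : MvPolynomial (Fin 2) L) :
    homogenization f = homogenizationOfDegree f.totalDegree f := by
  rw [homogenizationOfDegree, Module.Basis.constr_apply, homogenization]
  refine Finset.sum_congr rfl fun t _ => ?_
  simp only [smul_eq_C_mul, mul_assoc]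
  rfl

theorem homogenizationOfDegree_monomial (D : ℕ) (t : Fin 2 →₀ ℕ) (a : L) :
    homogenizationOfDegree D (monomial t a) =
      C a * (X 0 ^ (t 0) * X 1 ^ (t 1) * X 2 ^ (D - (t 0 + t 1))) := by
  have h1 : (monomial t a : MvPolynomial (Fin 2) L) = a • basisMonomials (Fin 2) L t := by
    simp [smul_monomial]
  rw [h1, map_smul, homogenizationOfDegree, Module.Basis.constr_basis, smul_eq_C_mul]

/-- The homogenization of `linPoly k c e (d + 1)`, of degree `2 ^ (k * d)`. -/
def homLinPoly (k : ℕ) (c e : ℕ → L) (d : ℕ) : MvPolynomial (Fin 3) L :=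
  ∑ i ∈ Finset.range (d + 1), (C (c i) * X 0 ^ (2 ^ (i * k)) + C (e i) * X 1 ^ (2 ^ (i * k))) *
    X 2 ^ (2 ^ (k * d) - 2 ^ (i * k))

theorem homogenization_linPoly {k d : ℕ} {c e : ℕ → L}
    (h : (linPoly k c e (d + 1)).totalDegree = 2 ^ (k * d)) :
    homogenization (linPoly k c e (d + 1)) = homLinPoly k c e d := by
  rw [homogenization_eq, h, linPoly, map_sum, homLinPoly]
  refine Finset.sum_congr rfl fun i _ => ?_
  rw [map_add, C_mul_X_pow_eq_monomial, C_mul_X_pow_eq_monomial, homogenizationOfDegree_monomial,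
    homogenizationOfDegree_monomial]
  simp
  ring

theorem isHomogeneous_homLinPoly (k : ℕ) (c e : ℕ → L) (d : ℕ) :
    (homLinPoly k c e d).IsHomogeneous (2 ^ (k * d)) := by
  refine IsHomogeneous.sum _ _ _ fun i hi => ?_
  have hle : 2 ^ (i * k) ≤ 2 ^ (k * d) := by
    rw [mul_comm]
    exact Nat.pow_le_pow_right (by norm_num)
      (Nat.mul_le_mul_left k (Nat.lt_succ_iff.mp (Finset.mem_range.mp hi)))
  have h1 : ∀ (a : L) (j : Fin 3), (C a * X j ^ (2 ^ (i * k)) : MvPolynomial (Fin 3) L).IsHomogeneous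
      (2 ^ (i * k)) := fun a j => by
    simpa using (isHomogeneous_C _ a).mul ((isHomogeneous_X L j).pow (2 ^ (i * k)))
  have h2 := ((h1 (c i) 0).add (h1 (e i) 1)).mul
    ((isHomogeneous_X L (2 : Fin 3)).pow (2 ^ (k * d) - 2 ^ (i * k)))
  rwa [one_mul, Nat.add_sub_cancel' hle] at h2

theorem eval_homLinPoly_of_eq_zero {k d : ℕ} (hk : k ≠ 0) (c e : ℕ → L) {Q : Fin 3 → L}
    (hQ : Q 2 = 0) : eval Q (homLinPoly k c e d) =
      c d * Q 0 ^ (2 ^ (k * d)) + e d * Q 1 ^ (2 ^ (k * d)) := by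
  rw [homLinPoly, map_sum, Finset.sum_range_succ, Finset.sum_eq_zero, zero_add]
  · simp [mul_comm d k]
  · intro i hi
    have : 2 ^ (i * k) < 2 ^ (k * d) := by
      rw [mul_comm]
      exact Nat.pow_lt_pow_right (by norm_num)
        (Nat.mul_lt_mul_of_pos_left (Finset.mem_range.mp hi) (Nat.pos_of_ne_zero hk))
    simp [hQ, Nat.sub_ne_zero_of_lt this]

/-- In characteristic 2 every power X ^ (2 ^ (ik)) with i > 0 has zero derivative, so only the
linear part contributes. -/
theorem eval_pderiv_homLinPoly [CharP L 2] {k : ℕ} (hk : k ≠ 0) (c e : ℕ → L) (d : ℕ)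
    (Q : Fin 3 → L) :
    eval Q (pderiv 0 (homLinPoly k c e d)) = c 0 * Q 2 ^ (2 ^ (k * d) - 1) ∧
    eval Q (pderiv 1 (homLinPoly k c e d)) = e 0 * Q 2 ^ (2 ^ (k * d) - 1) := by
  have h2 : (2 : L) = 0 := CharTwo.two_eq_zero
  constructor
  · rw [homLinPoly, map_sum, map_sum, Finset.sum_eq_single 0]
    · simp [Derivation.leibniz, Derivation.leibniz_pow, mul_comm]
    · intro i _ hi
      simp [Derivation.leibniz, Derivation.leibniz_pow, hi, hk, h2]
    · simp
  · rw [homLinPoly, map_sum, map_sum, Finset.sum_eq_single 0]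
    · simp [Derivation.leibniz, Derivation.leibniz_pow, mul_comm]
    · intro i _ hi
      simp [Derivation.leibniz, Derivation.leibniz_pow, hi, hk, h2]
    · simp

theorem exists_ne_zero_of_mul_sub_mul_eq_zero {K : Type*} [Field K] {a b c d : K}
    (h : a * d - b * c = 0) :
    ∃ α β : K, (α ≠ 0 ∨ β ≠ 0) ∧ α * a + β * c = 0 ∧ α * b + β * d = 0 := by
  by_cases h1 : c = 0 ∧ a = 0
  · by_cases h2 : d = 0 ∧ b = 0
    · exact ⟨1, 0, by simp, by simp [h1], by simp [h2]⟩
    · refine ⟨d, -b, ?_, by simp [h1], by ring⟩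
      rw [neg_ne_zero]; tauto
  · refine ⟨c, -a, ?_, by ring, by linear_combination -h⟩
    rw [neg_ne_zero]; tauto

end

/-! ### From multiplicity above one to a coefficient dependence -/

section

variable {K : Type*} [Field K]

theorem totalDegree_map_of_injective {L σ : Type*} [Field L] (f : K →+* L)
    (p : MvPolynomial σ K) : (map f p).totalDegree = p.totalDegree := by
  simp only [totalDegree, support_map_of_injective p f.injective]

/-- If the projective closures of two linearized curves meet with multiplicity larger than `1`, then
their leading forms or their linear parts are proportional. -/
theorem dependent_of_meetWithMultGtOne [CharP K 2] {k d₁ d₂ : ℕ} (hk : k ≠ 0) {c₁ e₁ c₂ e₂ : ℕ → K}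
    (h₁ : (linPoly k c₁ e₁ (d₁ + 1)).totalDegree = 2 ^ (k * d₁))
    (h₂ : (linPoly k c₂ e₂ (d₂ + 1)).totalDegree = 2 ^ (k * d₂))
    (h : MeetWithMultGtOne (linPoly k c₁ e₁ (d₁ + 1)) (linPoly k c₂ e₂ (d₂ + 1))) :
    c₁ d₁ ^ (2 ^ (k * d₂)) * e₂ d₂ ^ (2 ^ (k * d₁)) -
        e₁ d₁ ^ (2 ^ (k * d₂)) * c₂ d₂ ^ (2 ^ (k * d₁)) = 0 ∨
      c₁ 0 * e₂ 0 - e₁ 0 * c₂ 0 = 0 := by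
  set ι := algebraMap K (AlgebraicClosure K)
  have : CharP (AlgebraicClosure K) 2 := charP_of_injective_algebraMap ι.injective 2
  have hmap : ∀ (c e : ℕ → K) (d : ℕ),
      (linPoly k c e (d + 1)).totalDegree = 2 ^ (k * d) →
      homogenization (map ι (linPoly k c e (d + 1))) =
        homLinPoly k (fun i => ι (c i)) (fun i => ι (e i)) d := by
    intro c e d hd
    have e1 : map ι (linPoly k c e (d + 1)) =
        linPoly k (fun i => ι (c i)) (fun i => ι (e i)) (d + 1) := by
      simp [linPoly]
    rw [← totalDegree_map_of_injective ι, e1] at hd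
    rw [e1, homogenization_linPoly hd]
  obtain ⟨P, hA, hB, hP⟩ := h
  rw [projMult, hmap _ _ _ h₁, hmap _ _ _ h₂] at hP
  rw [hmap _ _ _ h₁] at hA
  rw [hmap _ _ _ h₂] at hB
  by_cases hP2 : P.rep 2 = 0
  · left
    apply ι.injective
    rw [eval_homLinPoly_of_eq_zero hk _ _ hP2] at hA hB
    -- Raised to the common degree 2 ^ (k d₁ + k d₂), the leading forms give a linear system in the
    -- same powers of the coordinates, with a nonzero solution.
    have hA' := congrArg (· ^ 2 ^ (k * d₂)) hA
    have hB' := congrArg (· ^ 2 ^ (k * d₁)) hB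
    simp only [add_pow_char_pow, mul_pow, ← pow_mul, ← pow_add] at hA' hB'
    rw [zero_pow (by positivity)] at hA' hB'
    rw [add_comm (k * d₂)] at hB'
    simp only [map_sub, map_mul, map_pow, map_zero]
    by_cases h0 : P.rep 0 = 0
    · have h1 : P.rep 1 ≠ 0 := fun h1 => P.rep_nonzero (by
        ext i; fin_cases i <;> assumption)
      refine (mul_eq_zero.mp ?_).resolve_right (pow_ne_zero (2 ^ (k * d₁ + k * d₂)) h1)
      linear_combination ι (c₁ d₁) ^ (2 ^ (k * d₂)) * hB' - ι (c₂ d₂) ^ (2 ^ (k * d₁)) * hA'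
    · refine (mul_eq_zero.mp ?_).resolve_right (pow_ne_zero (2 ^ (k * d₁ + k * d₂)) h0)
      linear_combination ι (e₂ d₂) ^ (2 ^ (k * d₁)) * hA' - ι (e₁ d₁) ^ (2 ^ (k * d₂)) * hB'
  · right
    by_contra hdet
    refine absurd hP (not_lt.mpr (affineMult_dehomogenization_le_one
      (isHomogeneous_homLinPoly _ _ _ _) (isHomogeneous_homLinPoly _ _ _ _) hA hB ?_ _
      (Function.ne_iff.mp P.rep_nonzero).choose_spec))
    rw [(eval_pderiv_homLinPoly hk _ _ _ _).1, (eval_pderiv_homLinPoly hk _ _ _ _).2,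
      (eval_pderiv_homLinPoly hk _ _ _ _).1, (eval_pderiv_homLinPoly hk _ _ _ _).2]
    have hd' : ι (c₁ 0) * ι (e₂ 0) - ι (e₁ 0) * ι (c₂ 0) ≠ 0 := by
      rw [← map_mul, ← map_mul, ← map_sub]
      exact (map_ne_zero ι).mpr hdet
    refine fun h => mul_ne_zero (mul_ne_zero (pow_ne_zero (2 ^ (k * d₁) - 1) hP2)
      (pow_ne_zero (2 ^ (k * d₂) - 1) hP2)) hd' ?_
    linear_combination h

end

/-! ### The bound on common zeros and its strict form -/

section

variable {K : Type*} [Field K] [Fintype K] [Algebra (ZMod 2) K]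

theorem finrank_add_lt_of_notMem {m k n : ℕ} (hm : Module.finrank (ZMod 2) K = m)
    (hk : Nat.gcd k m = 1) (hn : m ≤ n) (Z : Submodule (ZMod 2) (K × K))
    {W : Submodule K (MvPolynomial (Fin 2) K)} (hW : W ≤ linSpace K k n)
    (hWZ : ∀ p ∈ W, ∀ z ∈ Z, eval ![z.1, z.2] p = 0) {T : MvPolynomial (Fin 2) K}
    (hT : T ∈ linSpace K k n) (hTW : T ∉ W) (hTZ : ∀ z ∈ Z, eval ![z.1, z.2] T = 0) :
    Module.finrank K W + Module.finrank (ZMod 2) Z < 2 * n := by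
  have hle : W ⊔ Submodule.span K {T} ≤ linSpace K k n :=
    sup_le hW (by simpa using hT)
  have hlt : W < W ⊔ Submodule.span K {T} :=
    lt_of_le_of_ne le_sup_left fun h => hTW (h ▸ Submodule.mem_sup_right
      (Submodule.mem_span_singleton_self T))
  have : FiniteDimensional K (W ⊔ Submodule.span K {T} : Submodule K (MvPolynomial (Fin 2) K)) :=
    Submodule.finiteDimensional_of_le hle
  have h1 := Submodule.finrank_lt_finrank_of_lt hlt
  have h2 := finrank_add_finrank_le hm hk hn Z hle (fun p hp z hz => by
    obtain ⟨w, hw, q, hq, rfl⟩ := Submodule.mem_sup.mp hp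
    obtain ⟨a, rfl⟩ := Submodule.mem_span_singleton.mp hq
    simp [hWZ w hw z hz, hTZ z hz, smul_eval])
  omega

/-- The bound on the number of common zeros of two coprime linearized polynomials over `K`. -/
theorem finrank_zeros_le {m k d₁ d₂ : ℕ} (hm : Module.finrank (ZMod 2) K = m)
    (hk : Nat.gcd k m = 1) (hk0 : k ≠ 0) {A B : MvPolynomial (Fin 2) K}
    (hA : IsLinearized k A) (hB : IsLinearized k B)
    (hd₁ : A.totalDegree = 2 ^ (k * d₁)) (hd₂ : B.totalDegree = 2 ^ (k * d₂))
    (hcop : IsRelPrime A B) (Z : Submodule (ZMod 2) (K × K))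
    (hZ : ∀ z ∈ Z, eval ![z.1, z.2] A = 0 ∧ eval ![z.1, z.2] B = 0) :
    Module.finrank (ZMod 2) Z ≤ d₁ + d₂ ∧
      (MeetWithMultGtOne A B → Module.finrank (ZMod 2) Z < d₁ + d₂) := by
  classical
  have := charP_two K
  obtain ⟨c₁, e₁, hA'⟩ := exists_eq_linPoly hk0 hA hd₁
  obtain ⟨c₂, e₂, hB'⟩ := exists_eq_linPoly hk0 hB hd₂
  have hne : ∀ (p : MvPolynomial (Fin 2) K) (d : ℕ), p.totalDegree = 2 ^ d → p ≠ 0 := by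
    rintro _ d h rfl
    simp at h
    exact absurd h (by positivity)
  have hli : LinearIndependent K (powFamily k A B) := by
    refine linearIndependent_powFamily hk0 (hne _ _ hd₁) (hne _ _ hd₂) ?_ ?_ hcop
    · rw [hA' _ (Nat.lt_succ_self _)]; simp [linPoly]
    · rw [hB' _ (Nat.lt_succ_self _)]; simp [linPoly]
  -- Indices i < d₂ + m for A and i < d₁ + m for B are exactly those whose top index, i + d₁ or i +
  -- d₂, stays below n.
  set n := d₁ + d₂ + m with hn
  set s : Finset (ℕ ⊕ ℕ) := (Finset.range (d₂ + m)).disjSum (Finset.range (d₁ + m))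
  set W := Submodule.span K (powFamily k A B '' s)
  have hfr : Module.finrank K W = d₁ + d₂ + 2 * m := by
    have : W = Submodule.span K (Set.range fun i : s => powFamily k A B i) := by
      simp only [W, Set.image_eq_range]; rfl
    rw [this, finrank_span_eq_card (b := fun i : s => powFamily k A B i)
      (hli.comp _ Subtype.val_injective), Fintype.card_coe, Finset.card_disjSum, Finset.card_range, Finset.card_range]
    ring
  have hAV : A ∈ linSpace K k (d₁ + 1) := by
    rw [hA' _ (Nat.lt_succ_self _)]; exact linPoly_mem_linSpace _ _ _ le_rfl
  have hBV : B ∈ linSpace K k (d₂ + 1) := by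
    rw [hB' _ (Nat.lt_succ_self _)]; exact linPoly_mem_linSpace _ _ _ le_rfl
  have hW : W ≤ linSpace K k n := by
    refine Submodule.span_le.mpr ?_
    rintro _ ⟨i | i, hi, rfl⟩
    · have : i < d₂ + m := by simpa [s] using hi
      exact pow_mem_linSpace i hAV (by omega)
    · have : i < d₁ + m := by simpa [s] using hi
      exact pow_mem_linSpace i hBV (by omega)
  have hWZ : ∀ p ∈ W, ∀ z ∈ Z, eval ![z.1, z.2] p = 0 := by
    intro p hp z hz
    induction hp using Submodule.span_induction with
    | mem x hx =>
      obtain ⟨i | i, -, rfl⟩ := hx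
      · simp [powFamily, (hZ z hz).1]
      · simp [powFamily, (hZ z hz).2]
    | zero => simp
    | add x y _ _ hx hy => rw [map_add, hx, hy, add_zero]
    | smul a x _ hx => rw [smul_eval, hx, mul_zero]
  have hmn : m ≤ n := by omega
  refine ⟨?_, fun hmeet => ?_⟩
  · have := finrank_add_finrank_le hm hk hmn Z hW hWZ
    omega
  suffices ∃ T ∈ linSpace K k n, T ∉ W ∧ ∀ z ∈ Z, eval ![z.1, z.2] T = 0 by
    obtain ⟨T, hT, hTW, hTZ⟩ := this
    have := finrank_add_lt_of_notMem hm hk hmn Z hW hWZ hT hTW hTZ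
    omega
  rw [hA' _ (Nat.lt_succ_self _), hB' _ (Nat.lt_succ_self _)] at hmeet
  rcases dependent_of_meetWithMultGtOne hk0 (by rw [← hA' _ (Nat.lt_succ_self _), hd₁])
    (by rw [← hB' _ (Nat.lt_succ_self _), hd₂]) hmeet with h | h
  -- A further power 2 ^ (mk) turns the entries into the top coefficients of the first Frobenius
  -- powers of A and B not used in W.
  · have h' : c₁ d₁ ^ (2 ^ ((d₂ + m) * k)) * e₂ d₂ ^ (2 ^ ((d₁ + m) * k)) -
        e₁ d₁ ^ (2 ^ ((d₂ + m) * k)) * c₂ d₂ ^ (2 ^ ((d₁ + m) * k)) = 0 := by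
      have := congrArg (· ^ 2 ^ (m * k)) h
      simp only [sub_pow_char_pow, mul_pow, ← pow_mul, ← pow_add] at this
      rw [zero_pow (by positivity)] at this
      rw [← this]; ring_nf
    obtain ⟨α, β, hαβ, hα, hβ⟩ := exists_ne_zero_of_mul_sub_mul_eq_zero h'
    -- Both powers have top index n; α and β cancel those terms, which brings the combination into
    -- the space. Its indices lie just outside s, so independence keeps it out of W.
    refine ⟨α • powFamily k A B (Sum.inl (d₂ + m)) + β • powFamily k A B (Sum.inr (d₁ + m)),
      ?_, ?_, ?_⟩
    · have hA1 : A = linPoly k c₁ e₁ d₁ +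
          (C (c₁ d₁) * X 0 ^ (2 ^ (d₁ * k)) + C (e₁ d₁) * X 1 ^ (2 ^ (d₁ * k))) := by
        rw [hA' _ (Nat.lt_succ_self _), linPoly, Finset.sum_range_succ]; rfl
      have hB1 : B = linPoly k c₂ e₂ d₂ +
          (C (c₂ d₂) * X 0 ^ (2 ^ (d₂ * k)) + C (e₂ d₂) * X 1 ^ (2 ^ (d₂ * k))) := by
        rw [hB' _ (Nat.lt_succ_self _), linPoly, Finset.sum_range_succ]; rfl
      have key : α • powFamily k A B (Sum.inl (d₂ + m)) + β • powFamily k A B (Sum.inr (d₁ + m)) =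
          α • linPoly k c₁ e₁ d₁ ^ (2 ^ ((d₂ + m) * k)) +
          β • linPoly k c₂ e₂ d₂ ^ (2 ^ ((d₁ + m) * k)) := by
        simp only [powFamily, Sum.elim_inl, Sum.elim_inr]
        rw [hA1, hB1]
        simp only [add_pow_char_pow, mul_pow, ← pow_mul, ← pow_add, ← add_mul, ← C_pow,
          smul_eq_C_mul]
        rw [show d₁ + (d₂ + m) = n by omega, show d₂ + (d₁ + m) = n by omega]
        have hα' := congrArg (C (σ := Fin 2)) hα
        have hβ' := congrArg (C (σ := Fin 2)) hβ
        simp only [C_add, C_mul, C_0] at hα' hβ'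
        linear_combination X 0 ^ 2 ^ (n * k) * hα' + X 1 ^ 2 ^ (n * k) * hβ'
      rw [key]
      exact add_mem (Submodule.smul_mem _ _ (pow_mem_linSpace _
        (linPoly_mem_linSpace k c₁ e₁ le_rfl) (by omega))) (Submodule.smul_mem _ _
        (pow_mem_linSpace _ (linPoly_mem_linSpace k c₂ e₂ le_rfl) (by omega)))
    · intro hmem
      obtain ⟨h1, h2⟩ := hli.eq_zero_of_smul_add_smul_mem_span (by simp) (by simp [s])
        (by simp [s]) hmem
      tauto
    · intro z hz
      simp [powFamily, smul_eval, (hZ z hz).1, (hZ z hz).2]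
  · obtain ⟨α, β, hαβ, hα, hβ⟩ := exists_ne_zero_of_mul_sub_mul_eq_zero h
    have surj : ∀ b : K, ∃ x : K, x ^ 2 ^ k = b := fun b =>
      (iterateFrobeniusEquiv K 2 k).surjective b
    -- Since α A + β B has no linear part and K is perfect, it is a 2 ^ k-th power; its root T also
    -- vanishes on Z.
    choose r hr using fun i => surj (α * c₁ (i + 1) + β * c₂ (i + 1))
    choose t ht using fun i => surj (α * e₁ (i + 1) + β * e₂ (i + 1))
    have hT : (linPoly k r t (d₁ + d₂)) ^ (2 ^ k) = α • A + β • B := by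
      rw [hA' (d₁ + d₂ + 1) (by omega), hB' (d₁ + d₂ + 1) (by omega)]
      simp only [linPoly]
      rw [sum_pow_char_pow, Finset.sum_range_succ', Finset.sum_range_succ']
      simp only [add_pow_char_pow, mul_pow, ← pow_mul, ← pow_add, ← C_pow, hr, ht,
        smul_eq_C_mul, C_add, C_mul, add_mul, one_mul, zero_mul, pow_zero, pow_one, mul_add,
        Finset.mul_sum, Finset.sum_add_distrib]
      have hα' := congrArg (C (σ := Fin 2)) hα
      have hβ' := congrArg (C (σ := Fin 2)) hβ
      simp only [C_add, C_mul, C_0] at hα' hβ'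
      simp only [mul_assoc]
      linear_combination -X 0 * hα' - X 1 * hβ'
    refine ⟨linPoly k r t (d₁ + d₂), linPoly_mem_linSpace _ _ _ (by omega), ?_, ?_⟩
    · intro hmem
      -- If T were in W, then α A + β B would lie in the span of powers of index at least 1, against
      -- independence.
      have hpow : ∀ p ∈ W, p ^ (2 ^ k) ∈
          Submodule.span K (powFamily k A B '' {Sum.inl 0, Sum.inr 0}ᶜ) := by
        intro p hp
        induction hp using Submodule.span_induction with
        | mem x hx =>
          obtain ⟨i | i, -, rfl⟩ := hx
          · refine Submodule.subset_span ⟨Sum.inl (i + 1), by simp, ?_⟩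
            simp [powFamily, ← pow_mul, ← pow_add, add_mul]
          · refine Submodule.subset_span ⟨Sum.inr (i + 1), by simp, ?_⟩
            simp [powFamily, ← pow_mul, ← pow_add, add_mul]
        | zero => rw [zero_pow (by positivity)]; exact zero_mem _
        | add x y _ _ hx hy => rw [add_pow_char_pow]; exact add_mem hx hy
        | smul a x _ hx => rw [smul_pow]; exact Submodule.smul_mem _ _ hx
      have h1 := hpow _ hmem
      rw [hT] at h1
      obtain ⟨h1, h2⟩ := hli.eq_zero_of_smul_add_smul_mem_span (i := Sum.inl 0) (j := Sum.inr 0)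
        (s := {Sum.inl 0, Sum.inr 0}ᶜ) (α := α) (β := β) (by simp) (by simp) (by simp)
        (by simpa [powFamily] using h1)
      tauto
    · intro z hz
      have := congrArg (eval ![z.1, z.2]) hT
      rw [map_pow, map_add, smul_eval, smul_eval, (hZ z hz).1, (hZ z hz).2] at this
      simpa using this

end

/-- For k = 0 every exponent is 1, so the polynomial is a linear form. -/
theorem isLinearized_one_of_zero {K : Type*} [Field K] {p : MvPolynomial (Fin 2) K}
    (hp : IsLinearized 0 p) : IsLinearized 1 p := by
  obtain ⟨d, c, e, h⟩ := hp
  refine ⟨0, fun _ => ∑ i ∈ Finset.range (d + 1), c i, fun _ => ∑ i ∈ Finset.range (d + 1), e i, ?_⟩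
  simp [h, Finset.sum_add_distrib, Finset.sum_mul]

end

theorem mainTheorem7 {K : Type*} [Field K] [Fintype K] [Algebra (ZMod 2) K] (m : ℕ)
    (hK : Fintype.card K = 2 ^ m)
    (F : MvPolynomial (Fin 2) K) (hF : PlaneBoolean.IsQuadratic (PlaneBoolean.traceFun F))
    (A B : MvPolynomial (Fin 2) K)
    (hAB : PlaneBoolean.RepresentsDeriv (PlaneBoolean.traceFun F) A B)
    (k : ℕ) (hk : Nat.gcd k m = 1)
    (hA : PlaneBoolean.IsLinearized k A) (hB : PlaneBoolean.IsLinearized k B)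
    (d₁ d₂ : ℕ) (hd₁ : A.totalDegree = 2 ^ (k * d₁)) (hd₂ : B.totalDegree = 2 ^ (k * d₂))
    (hcop : IsRelPrime A B) :
    ∃ s : ℕ, PlaneBoolean.IsPlateaued (PlaneBoolean.traceFun F) s ∧ s ≤ d₁ + d₂ ∧
      (PlaneBoolean.MeetWithMultGtOne A B → s < d₁ + d₂) := by
  have hm : Module.finrank (ZMod 2) K = m := by
    have := Module.card_eq_pow_finrank (K := ZMod 2) (V := K)
    rw [ZMod.card, hK] at this
    exact (Nat.pow_right_injective le_rfl this).symm
  have hZ := fun z => (mem_radical_iff_of_representsDeriv hAB z).mp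
  refine ⟨_, isPlateaued_radical _ (derivLinearPart_additive hAB), ?_⟩
  rcases eq_or_ne k 0 with rfl | hk0
  -- For k = 0 both degrees are 1, whatever d₁ and d₂ are, so the case k = 1 applies with both
  -- parameters 0.
  · have := finrank_zeros_le hm (k := 1) (d₁ := 0) (d₂ := 0) (by simp) one_ne_zero
      (isLinearized_one_of_zero hA) (isLinearized_one_of_zero hB) (by simpa using hd₁) (by simpa using hd₂) hcop _ hZ
    exact ⟨this.1.trans (Nat.zero_le _), fun h => (this.2 h).trans_le (Nat.zero_le _)⟩
  · exact finrank_zeros_le hm hk hk0 hA hB hd₁ hd₂ hcop _ hZ
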